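/- Let $n\ge 2$ and let $A=[a_1\ \cdots\ a_n]\in\mathbb C^{n\times n}$ have linearly independent columns of unit Euclidean length. For an ordered pair of distinct indices $(i,j)$ let $\mathrm{orth}(A,i,j)$ be the matrix obtained from $A$ by replacing the column $a_i$ with $$\frac{a_i-\langle a_i,a_j\rangle a_j}{\|a_i-\langle a_i,a_j\rangle a_j\|},\qquad \langle x,y\rangle=y^*x,$$ and keeping all other columns. Let $(i_0,j_0),(i_1,j_1),\dots$ be independent and uniformly distributed on the $n(n-1)$ ordered pairs of distinct indices, and put $A_0=A$, $A_{t+1}=\mathrm{orth}(A_t,i_t,j_t)$. Let $$d_j(A)=\operatorname{dist}\bigl(a_j,\operatorname{span}\{a_k:k\ne j\}\bigr),\qquad \Phi(A)=-\sum_{j=1}^n\log d_j(A),\qquad \kappa(A)=\frac{\sigma_1(A)}{\sigma_n(A)},$$ where $\sigma_1(A)\ge\dots\ge\sigma_n(A)>0$ are the singular values. If $\varepsilon,\delta\in(0,0.01)$ and the integer $t\ge 0$ satisfies $$t\ \ge\ 200\,n^2\,\Phi(A)\log\bigl(7\Phi(A)/n\bigr)\quad(\text{with }0\log 0=0)\qquad\text{and}\qquad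 t\ \ge\ \frac{48\,n^4}{\delta\,\varepsilon^2},$$ then $$\Pr\bigl(\kappa(A_t)\ge 1+\varepsilon\bigr)\le\delta .$$ In particular, one can take $\varepsilon,\delta\to0$ as $t\to\infty$: there are sequences $\varepsilon_t,\delta_t\in(0,0.01)$ with $\varepsilon_t\to0$ and $\delta_t\to0$ such that, for all sufficiently large $t$, both conditions on $t$ hold with $\varepsilon=\varepsilon_t$, $\delta=\delta_t$, and hence $\Pr(\kappa(A_t)\ge1+\varepsilon_t)\le\delta_t$. -/

import Mathlib

open MeasureTheory ProbabilityTheory Filter Topology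

noncomputable section

/-- The `k`-th column of a complex matrix, as a vector of Euclidean space (with the `ℓ²` norm). -/
def colVec {n : ℕ} (A : Matrix (Fin n) (Fin n) ℂ) (k : Fin n) : EuclideanSpace ℂ (Fin n) :=
  WithLp.toLp 2 (fun r => A r k)

/-- Ordered pairs of distinct indices. -/
abbrev IdxPair (n : ℕ) : Type := {p : Fin n × Fin n // p.1 ≠ p.2}

/-- The component `a_i - ⟨a_i, a_j⟩ a_j` of `a_i` perpendicular to the (unit) column `a_j`.
Mathlib's inner product is conjugate-linear in the first slot, so the coefficient of the
projection of `a_i` on `a_j` is `inner ℂ a_j a_i`. -/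
def perpPart {n : ℕ} (A : Matrix (Fin n) (Fin n) ℂ) (i j : Fin n) : EuclideanSpace ℂ (Fin n) :=
  colVec A i - inner ℂ (colVec A j) (colVec A i) • colVec A j

/-- One pairwise orthogonalization step: for `p = (i, j)`, column `i` is replaced by its component
perpendicular to column `j`, renormalized; all other columns are kept. -/
def orthStep {n : ℕ} (A : Matrix (Fin n) (Fin n) ℂ) (p : IdxPair n) :
    Matrix (Fin n) (Fin n) ℂ :=
  Matrix.of fun r k =>
    if k = p.1.1 then
      (((‖perpPart A p.1.1 p.1.2‖⁻¹ : ℝ) : ℂ) • perpPart A p.1.1 p.1.2) r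
    else A r k

/-- The matrix `A_t` obtained from `A_0 = A` by `A_{s+1} = orth(A_s, i_s, j_s)`,
where `(i_s, j_s) = p s`. -/
def orthIter {n : ℕ} (A : Matrix (Fin n) (Fin n) ℂ) (p : ℕ → IdxPair n) :
    ℕ → Matrix (Fin n) (Fin n) ℂ
  | 0 => A
  | t + 1 => orthStep (orthIter A p t) (p t)

/-- `d_j(A)`: the distance from column `j` to the span of the other columns. -/
def colDist {n : ℕ} (A : Matrix (Fin n) (Fin n) ℂ) (j : Fin n) : ℝ :=
  Metric.infDist (colVec A j)
    (Submodule.span ℂ (colVec A '' {k | k ≠ j}) : Set (EuclideanSpace ℂ (Fin n)))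

/-- The potential `Φ(A) = -∑_j log d_j(A)`. -/
def logDistPotential {n : ℕ} (A : Matrix (Fin n) (Fin n) ℂ) : ℝ :=
  -∑ j, Real.log (colDist A j)

/-- The condition number `σ₁(A) / σₙ(A)`, the quotient of the largest and the smallest of the `n`
singular values (Mathlib lists them in descending order, starting from index `0`).
It is used for invertible matrices, where `σₙ(A) > 0`. -/
def condNumber {n : ℕ} (A : Matrix (Fin n) (Fin n) ℂ) : ℝ :=
  (Matrix.toEuclideanLin A).singularValues 0 / (Matrix.toEuclideanLin A).singularValues (n - 1)

end

/-! Everything rests on the excess `E(A) = ‖A⁻¹‖_F² - n`. A step multiplies `A⁻¹` on the left by a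
matrix that scales row `i` by `√(1 - |c|²)` and adds `c` times row `i` to row `j`, where `c = ⟨a_i,
a_j⟩`. The two `|c|²` terms cancel, so `E` changes by an expression linear in the entries of `G =
A*A` times those of `G⁻¹`. Summed over all pairs this is a trace, and the mean of `E` contracts by
exactly `1 - 2/(n(n-1))` (`sum_invExcess_orthStep`).

Unit columns give `∑ σ² = n`, hence `E = ∑ (σ² + σ⁻² - 2) ≥ 0`, and `κ ≥ 1 + ε` forces `E ≥ ε²`
(`sq_le_invExcess`). Row `j` of `A⁻¹` has norm at most `1/d_j`, so `E(A) ≤ n exp(2Φ)` at the start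
(`invExcess_le`). Markov's inequality bounds the probability by `exp(-2t/n²) · n exp(2Φ) / ε²`, and
the two conditions on `t` make this at most `δ`. -/

noncomputable section

/-! ### The excess and its exact change under one step. -/

/-- The squared Frobenius norm of `A⁻¹` minus the dimension. It vanishes on unitary matrices. -/
def invExcess {n : ℕ} (A : Matrix (Fin n) (Fin n) ℂ) : ℝ :=
  (∑ k, ∑ r, ‖A⁻¹ k r‖ ^ 2) - n

/-- The `k`-th row of the inverse, as a vector of Euclidean space. -/
def invRow {n : ℕ} (A : Matrix (Fin n) (Fin n) ℂ) (k : Fin n) : EuclideanSpace ℂ (Fin n) :=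
  WithLp.toLp 2 (A⁻¹ k)

lemma invExcess_eq_sum_norm {n : ℕ} (A : Matrix (Fin n) (Fin n) ℂ) :
    invExcess A = ∑ k, ‖invRow A k‖ ^ 2 - n := by
  simp [invExcess, invRow, EuclideanSpace.norm_sq_eq]

lemma inner_colVec {n : ℕ} (A : Matrix (Fin n) (Fin n) ℂ) (j i : Fin n) :
    inner ℂ (colVec A j) (colVec A i) = (A.conjTranspose * A) j i := by
  simp [colVec, PiLp.inner_apply, Matrix.mul_apply, mul_comm]

/-- The indices swap relative to `inner_colVec` because rows, not columns, are paired by an inner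
product conjugate-linear in its first slot. -/
lemma inner_invRow {n : ℕ} (A : Matrix (Fin n) (Fin n) ℂ) (j i : Fin n) :
    inner ℂ (invRow A j) (invRow A i) = (A⁻¹ * (A⁻¹).conjTranspose) i j := by
  simp [invRow, PiLp.inner_apply, Matrix.mul_apply]

lemma perpPart_ne_zero {n : ℕ} {A : Matrix (Fin n) (Fin n) ℂ} (hA : IsUnit A.det) {i j : Fin n}
    (hij : i ≠ j) : perpPart A i j ≠ 0 := by
  intro h
  have h1 : ∀ k l, ∑ r, A⁻¹ k r * A r l = if k = l then 1 else 0 := fun k l => by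
    rw [← Matrix.mul_apply, Matrix.nonsing_inv_mul A hA, Matrix.one_apply]
  -- Row `i` of `A⁻¹` is the functional dual to column `i`; it kills `a_j`.
  have h2 : ∑ r, A⁻¹ i r * (perpPart A i j) r = 1 := by
    simp only [perpPart, colVec, PiLp.sub_apply, PiLp.smul_apply, smul_eq_mul, mul_sub,
      Finset.sum_sub_distrib, mul_left_comm _ (inner ℂ _ _), ← Finset.mul_sum, h1]
    simp [hij]
  simp [h] at h2

lemma norm_perpPart_sq {n : ℕ} {A : Matrix (Fin n) (Fin n) ℂ} (hunit : ∀ k, ‖colVec A k‖ = 1)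
    (i j : Fin n) :
    ‖perpPart A i j‖ ^ 2 = 1 - ‖inner ℂ (colVec A j) (colVec A i)‖ ^ 2 := by
  rw [perpPart, @norm_sub_sq ℂ, inner_smul_right, norm_smul, hunit, hunit,
    ← inner_conj_symm (colVec A i) (colVec A j), RCLike.mul_conj]
  norm_cast
  ring

lemma colVec_orthStep {n : ℕ} (A : Matrix (Fin n) (Fin n) ℂ) (p : IdxPair n) (k : Fin n) :
    colVec (orthStep A p) k = if k = p.1.1 then
      ((‖perpPart A p.1.1 p.1.2‖⁻¹ : ℝ) : ℂ) • perpPart A p.1.1 p.1.2 else colVec A k := by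
  ext r
  by_cases h : k = p.1.1 <;> simp [colVec, orthStep, h]

lemma norm_colVec_orthStep {n : ℕ} {A : Matrix (Fin n) (Fin n) ℂ}
    (hunit : ∀ k, ‖colVec A k‖ = 1) (hA : IsUnit A.det) (p : IdxPair n) (k : Fin n) :
    ‖colVec (orthStep A p) k‖ = 1 := by
  rw [colVec_orthStep]
  split_ifs
  · rw [norm_smul]
    have := perpPart_ne_zero hA p.2
    simp [this]
  · exact hunit k

/-- The matrix `M` with `orthStep A p * M = A`. -/
def undoOrthStep {n : ℕ} (A : Matrix (Fin n) (Fin n) ℂ) (p : IdxPair n) :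
    Matrix (Fin n) (Fin n) ℂ :=
  1 + Matrix.single p.1.1 p.1.1 ((‖perpPart A p.1.1 p.1.2‖ : ℂ) - 1)
    + Matrix.single p.1.2 p.1.1 (inner ℂ (colVec A p.1.2) (colVec A p.1.1))

lemma orthStep_mul_undo {n : ℕ} {A : Matrix (Fin n) (Fin n) ℂ} (hA : IsUnit A.det)
    (p : IdxPair n) : orthStep A p * undoOrthStep A p = A := by
  obtain ⟨⟨i, j⟩, hij⟩ := p
  have h0 : (‖perpPart A i j‖ : ℂ) ≠ 0 := by
    simpa using perpPart_ne_zero hA hij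
  ext r k
  simp only [undoOrthStep, mul_add, mul_one, Matrix.add_apply]
  by_cases hk : k = i
  · subst hk
    simp only [Matrix.mul_single_apply_same, orthStep, Matrix.of_apply, if_pos,
      if_neg (Ne.symm hij), PiLp.smul_apply, smul_eq_mul]
    push_cast
    have : (perpPart A k j) r = A r k - inner ℂ (colVec A j) (colVec A k) * A r j := by
      simp [perpPart, colVec]
    field_simp
    rw [this]
    ring
  · simp [Matrix.mul_single_apply_of_ne, hk, orthStep]

lemma isUnit_det_orthStep {n : ℕ} {A : Matrix (Fin n) (Fin n) ℂ} (hA : IsUnit A.det)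
    (p : IdxPair n) : IsUnit (orthStep A p).det := by
  rw [← orthStep_mul_undo hA p, Matrix.det_mul] at hA
  exact isUnit_of_mul_isUnit_left hA

lemma inv_orthStep {n : ℕ} {A : Matrix (Fin n) (Fin n) ℂ} (hA : IsUnit A.det)
    (p : IdxPair n) : (orthStep A p)⁻¹ = undoOrthStep A p * A⁻¹ := by
  apply Matrix.inv_eq_right_inv
  rw [← Matrix.mul_assoc, orthStep_mul_undo hA, Matrix.mul_nonsing_inv A hA]

lemma invRow_orthStep {n : ℕ} {A : Matrix (Fin n) (Fin n) ℂ} (hA : IsUnit A.det)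
    (p : IdxPair n) (k : Fin n) :
    invRow (orthStep A p) k =
      if k = p.1.1 then (‖perpPart A p.1.1 p.1.2‖ : ℂ) • invRow A p.1.1
      else if k = p.1.2 then
        invRow A p.1.2 + inner ℂ (colVec A p.1.2) (colVec A p.1.1) • invRow A p.1.1
      else invRow A k := by
  obtain ⟨⟨i, j⟩, hij⟩ := p
  have hij : i ≠ j := hij
  ext r
  simp only [invRow, inv_orthStep hA, undoOrthStep, add_mul, one_mul, Matrix.add_apply]
  by_cases hk : k = i
  · subst hk
    rw [if_pos rfl, Matrix.single_mul_apply_same, Matrix.single_mul_apply_of_ne _ _ _ _ _ hij]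
    simp
    ring
  · rw [if_neg hk, Matrix.single_mul_apply_of_ne _ _ _ _ _ hk]
    by_cases hk' : k = j
    · subst hk'
      simp
    · rw [if_neg hk', Matrix.single_mul_apply_of_ne _ _ _ _ _ hk']
      simp

/-- Row `i` loses `‖c‖² ‖row i‖²` and row `j` gains the same amount plus a cross term; only the
cross term survives. -/
lemma invExcess_orthStep {n : ℕ} {A : Matrix (Fin n) (Fin n) ℂ}
    (hunit : ∀ k, ‖colVec A k‖ = 1) (hA : IsUnit A.det) (p : IdxPair n) :
    invExcess (orthStep A p) = invExcess A +
      2 * ((A.conjTranspose * A) p.1.2 p.1.1 * (A⁻¹ * (A⁻¹).conjTranspose) p.1.1 p.1.2).re := by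
  rw [← inner_colVec, ← inner_invRow]
  set c := inner ℂ (colVec A p.1.2) (colVec A p.1.1) with hc
  set q := (c * inner ℂ (invRow A p.1.2) (invRow A p.1.1)).re with hq
  have hij : p.1.1 ≠ p.1.2 := p.2
  have hk : ∀ k, ‖invRow (orthStep A p) k‖ ^ 2 = ‖invRow A k‖ ^ 2
      + (if k = p.1.1 then -(‖c‖ ^ 2 * ‖invRow A p.1.1‖ ^ 2) else 0)
      + (if k = p.1.2 then 2 * q + ‖c‖ ^ 2 * ‖invRow A p.1.1‖ ^ 2 else 0) := by
    intro k
    rw [invRow_orthStep hA]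
    by_cases h1 : k = p.1.1
    · have h2 : k ≠ p.1.2 := h1 ▸ hij
      rw [if_pos h1, if_pos h1, if_neg h2, norm_smul, mul_pow, Complex.norm_real, norm_norm,
        norm_perpPart_sq hunit, h1]
      ring
    · rw [if_neg h1, if_neg h1]
      by_cases h2 : k = p.1.2
      · rw [if_pos h2, if_pos h2, @norm_add_sq ℂ, inner_smul_right, norm_smul, h2, hq]
        simp only [RCLike.re_to_complex]
        ring
      · simp [h2]
  rw [invExcess_eq_sum_norm, invExcess_eq_sum_norm]
  simp only [hk, Finset.sum_add_distrib, Finset.sum_ite_eq', Finset.mem_univ, if_true]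
  ring

lemma sum_idxPair {n : ℕ} (F : Fin n → Fin n → ℝ) :
    ∑ p : IdxPair n, F p.1.1 p.1.2 = ∑ i, ∑ j, F i j - ∑ i, F i i := by
  have h1 : ∑ p : IdxPair n, F p.1.1 p.1.2
      = ∑ p : Fin n × Fin n with p.1 ≠ p.2, F p.1 p.2 :=
    (Finset.sum_subtype _ (by simp) (fun p : Fin n × Fin n => F p.1 p.2)).symm
  rw [h1, Finset.sum_filter, Fintype.sum_prod_type, ← Finset.sum_sub_distrib]
  refine Finset.sum_congr rfl fun i _ => ?_
  have : ∀ j, (if i ≠ j then F i j else 0) = F i j - if i = j then F i j else 0 := by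
    intro j; by_cases h : i = j <;> simp [h]
  simp [this]

lemma card_idxPair (n : ℕ) : (Fintype.card (IdxPair n) : ℝ) = n * (n - 1) := by
  have := sum_idxPair (n := n) fun _ _ => 1
  simp only [Finset.sum_const, Finset.card_univ, Fintype.card_fin, nsmul_eq_mul, mul_one] at this
  rw [this]
  ring

/-- Averaged over the pairs, one step contracts the excess by the exact factor
`1 - 2 / (n (n - 1))`. -/
lemma sum_invExcess_orthStep {n : ℕ} {A : Matrix (Fin n) (Fin n) ℂ}
    (hunit : ∀ k, ‖colVec A k‖ = 1) (hA : IsUnit A.det) :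
    ∑ p : IdxPair n, invExcess (orthStep A p) = (n * (n - 1) - 2 : ℝ) * invExcess A := by
  simp only [invExcess_orthStep hunit hA, Finset.sum_add_distrib, ← Finset.mul_sum]
  rw [sum_idxPair (fun i j =>
    ((A.conjTranspose * A) j i * (A⁻¹ * (A⁻¹).conjTranspose) i j).re)]
  -- The full double sum is `tr(G G⁻¹) = n`; the diagonal, to be removed, is `∑ ‖row i‖²` since `G`
  -- has unit diagonal. The difference is `-E`.
  have hall : ∑ i, ∑ j, ((A.conjTranspose * A) j i * (A⁻¹ * (A⁻¹).conjTranspose) i j).re = n := by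
    have : (A.conjTranspose * A) * (A⁻¹ * (A⁻¹).conjTranspose) = 1 := by
      rw [Matrix.mul_assoc, Matrix.mul_nonsing_inv_cancel_left _ _ hA, ← Matrix.conjTranspose_mul,
        Matrix.nonsing_inv_mul A hA, Matrix.conjTranspose_one]
    rw [Finset.sum_comm]
    simp_rw [← Complex.re_sum, ← Matrix.mul_apply, this]
    simp
  have hdiag : ∀ i, ((A.conjTranspose * A) i i * (A⁻¹ * (A⁻¹).conjTranspose) i i).re
      = ‖invRow A i‖ ^ 2 := by
    intro i
    rw [← inner_colVec, ← inner_invRow, inner_self_eq_norm_sq_to_K, inner_self_eq_norm_sq_to_K,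
      hunit]
    have : ((‖invRow A i‖ : ℂ) ^ 2).re = ‖invRow A i‖ ^ 2 := by
      rw [← Complex.ofReal_pow, Complex.ofReal_re]
    simpa using this
  rw [hall]
  simp only [hdiag, Finset.sum_const, Finset.card_univ, nsmul_eq_mul, card_idxPair]
  rw [invExcess_eq_sum_norm]
  ring

/-! ### The excess in terms of singular values. -/

lemma trace_toEuclideanLin {n : ℕ} (M : Matrix (Fin n) (Fin n) ℂ) :
    LinearMap.trace ℂ _ (Matrix.toEuclideanLin M) = M.trace := by
  rw [LinearMap.trace_eq_sum_inner _ (EuclideanSpace.basisFun (Fin n) ℂ)]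
  simp [Matrix.trace, EuclideanSpace.inner_single_left, Matrix.toLpLin_apply]

/-- The singular values are positive, and the excess is the sum of `σ² + σ⁻² - 2` over them. -/
lemma invExcess_eq_sum_singularValues {n : ℕ} {A : Matrix (Fin n) (Fin n) ℂ}
    (hunit : ∀ k, ‖colVec A k‖ = 1) (hA : IsUnit A.det) :
    (∀ i : Fin n, 0 < (Matrix.toEuclideanLin A).singularValues i) ∧
    invExcess A = ∑ i : Fin n, ((Matrix.toEuclideanLin A).singularValues i ^ 2
      + ((Matrix.toEuclideanLin A).singularValues i ^ 2)⁻¹ - 2) := by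
  set T := Matrix.toEuclideanLin A with hT
  have hfin : Module.finrank ℂ (EuclideanSpace ℂ (Fin n)) = n := by simp
  have hinj : Function.Injective T := by
    intro x y hxy
    have h := congrArg (fun v => A⁻¹.mulVec (WithLp.ofLp v)) hxy
    simp only [hT, Matrix.toLpLin_apply, Matrix.mulVec_mulVec,
      Matrix.nonsing_inv_mul A hA, Matrix.one_mulVec] at h
    exact WithLp.ofLp_injective 2 h
  have hpos : ∀ i : Fin n, 0 < T.singularValues i := fun i =>
    T.injective_iff_forall_lt_finrank_singularValues_pos.1 hinj i (by rw [hfin]; exact i.2)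
  refine ⟨hpos, ?_⟩
  have hsym := T.isSymmetric_adjoint_comp_self
  set b := hsym.eigenvectorBasis hfin with hb
  have hS : ∀ i, (LinearMap.adjoint T ∘ₗ T) (b i) = ((T.singularValues i ^ 2 : ℝ) : ℂ) • b i := by
    intro i
    rw [T.sq_singularValues_fin hfin]
    exact hsym.apply_eigenvectorBasis hfin i
  have hSM : LinearMap.adjoint T ∘ₗ T = Matrix.toEuclideanLin (A.conjTranspose * A) := by
    rw [hT, ← Matrix.toEuclideanLin_conjTranspose_eq_adjoint]
    ext x
    simp [Matrix.toLpLin_apply]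
  set K := Matrix.toEuclideanLin (A⁻¹ * (A⁻¹).conjTranspose) with hK
  have hKS : ∀ x, K ((LinearMap.adjoint T ∘ₗ T) x) = x := by
    intro x
    have h1 : (A⁻¹ * (A⁻¹).conjTranspose) * (A.conjTranspose * A) = 1 := by
      rw [Matrix.mul_assoc, ← Matrix.mul_assoc _ A.conjTranspose, ← Matrix.conjTranspose_mul,
        Matrix.mul_nonsing_inv A hA, Matrix.conjTranspose_one, Matrix.one_mul,
        Matrix.nonsing_inv_mul A hA]
    rw [hSM, hK, Matrix.toLpLin_apply, Matrix.toLpLin_apply]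
    simp only [Matrix.mulVec_mulVec, h1, Matrix.one_mulVec]
  have hKb : ∀ i, K (b i) = (((T.singularValues i ^ 2)⁻¹ : ℝ) : ℂ) • b i := by
    intro i
    have h := hKS (b i)
    have hne : ((T.singularValues i ^ 2 : ℝ) : ℂ) ≠ 0 := by
      exact_mod_cast (pow_pos (hpos i) 2).ne'
    rw [hS, map_smul] at h
    rw [Complex.ofReal_inv]
    exact (eq_inv_smul_iff₀ hne).2 h
  -- Trace of `A*A` in its eigenbasis `b` against the standard basis, where the diagonal entries are
  -- `‖a_k‖² = 1`.
  have htrS : ∑ i : Fin n, T.singularValues i ^ 2 = n := by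
    have h := LinearMap.trace_eq_sum_inner (LinearMap.adjoint T ∘ₗ T) b
    rw [hSM, trace_toEuclideanLin, ← hSM] at h
    simp only [hS, inner_smul_right, inner_self_eq_norm_sq_to_K, b.norm_eq_one] at h
    simp only [Matrix.trace, Matrix.diag, ← inner_colVec, inner_self_eq_norm_sq_to_K, hunit] at h
    simp at h
    exact_mod_cast h.symm
  have htrK : ∑ i : Fin n, (T.singularValues i ^ 2)⁻¹ = ∑ k, ‖invRow A k‖ ^ 2 := by
    have h := LinearMap.trace_eq_sum_inner K b
    rw [hK, trace_toEuclideanLin, ← hK] at h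
    simp only [hKb, inner_smul_right, inner_self_eq_norm_sq_to_K, b.norm_eq_one] at h
    simp only [Matrix.trace, Matrix.diag, ← inner_invRow, inner_self_eq_norm_sq_to_K] at h
    simp at h
    exact_mod_cast h.symm
  rw [Finset.sum_sub_distrib, Finset.sum_add_distrib, htrS, htrK, invExcess_eq_sum_norm]
  simp
  ring

lemma add_inv_sub_two_nonneg {x : ℝ} (hx : 0 < x) : 0 ≤ x + x⁻¹ - 2 := by
  have : x + x⁻¹ - 2 = (x - 1) ^ 2 / x := by field_simp; ring
  rw [this]; positivity

lemma invExcess_nonneg {n : ℕ} {A : Matrix (Fin n) (Fin n) ℂ}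
    (hunit : ∀ k, ‖colVec A k‖ = 1) (hA : IsUnit A.det) : 0 ≤ invExcess A := by
  obtain ⟨hpos, h⟩ := invExcess_eq_sum_singularValues hunit hA
  rw [h]
  exact Finset.sum_nonneg fun i _ => add_inv_sub_two_nonneg (pow_pos (hpos i) 2)

lemma sq_le_of_ratio {x y ε : ℝ} (hy : 0 < y) (hε : 0 < ε) (hε1 : ε ≤ 1)
    (h : 1 + ε ≤ x / y) :
    ε ^ 2 ≤ (x ^ 2 + (x ^ 2)⁻¹ - 2) + (y ^ 2 + (y ^ 2)⁻¹ - 2) := by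
  obtain ⟨u, hu⟩ : ∃ u, u = x / y - 1 := ⟨_, rfl⟩
  have hxu : x = (1 + u) * y := by rw [hu]; field_simp; ring
  have hεu : ε ≤ u := by linarith
  have hu0 : 0 < 1 + u := by linarith
  -- For a fixed ratio `1 + u = x / y`, the minimum is attained at `x * y = 1`; the last term, with
  -- `(1 + u) * y ^ 2 = x * y`, measures the deviation from it.
  have h1 : (x ^ 2 + (x ^ 2)⁻¹ - 2) + (y ^ 2 + (y ^ 2)⁻¹ - 2)
      = 2 * (u ^ 2 / (1 + u)) + ((1 + (1 + u) ^ 2) / (1 + u)) *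
        ((1 + u) * y ^ 2 - 1) ^ 2 / ((1 + u) * y ^ 2) := by
    rw [hxu]; field_simp; ring
  have h2 : ε ^ 2 ≤ 2 * (u ^ 2 / (1 + u)) := by
    rw [← mul_div_assoc, le_div_iff₀ hu0]
    nlinarith [mul_le_mul hεu hεu hε.le (by linarith), mul_pos hε hε,
      mul_le_mul_of_nonneg_left hε1 hε.le,
      mul_nonneg (hε.le.trans hεu) (sub_nonneg.2 hεu)]
  rw [h1]
  have : 0 ≤ ((1 + (1 + u) ^ 2) / (1 + u)) *
        ((1 + u) * y ^ 2 - 1) ^ 2 / ((1 + u) * y ^ 2) := by positivity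
  linarith

lemma sq_le_invExcess {n : ℕ} (hn : 2 ≤ n) {A : Matrix (Fin n) (Fin n) ℂ}
    (hunit : ∀ k, ‖colVec A k‖ = 1) (hA : IsUnit A.det) {ε : ℝ} (hε : 0 < ε) (hε1 : ε ≤ 1)
    (h : 1 + ε ≤ condNumber A) : ε ^ 2 ≤ invExcess A := by
  obtain ⟨hpos, hsum⟩ := invExcess_eq_sum_singularValues hunit hA
  rw [condNumber] at h
  rw [hsum]
  let a : Fin n := ⟨0, by omega⟩
  let b : Fin n := ⟨n - 1, by omega⟩
  have hab : a ≠ b := by simp [a, b]; omega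
  refine (sq_le_of_ratio (hpos b) hε hε1 h).trans ?_
  rw [← Finset.sum_pair hab (f := fun i : Fin n => (Matrix.toEuclideanLin A).singularValues i ^ 2
      + ((Matrix.toEuclideanLin A).singularValues i ^ 2)⁻¹ - 2)]
  exact Finset.sum_le_sum_of_subset_of_nonneg (Finset.subset_univ _)
    fun i _ _ => add_inv_sub_two_nonneg (pow_pos (hpos i) 2)

/-! ### Column distances and the initial excess. -/

lemma isUnit_det_of_linearIndependent_colVec {n : ℕ} {A : Matrix (Fin n) (Fin n) ℂ}
    (h : LinearIndependent ℂ (colVec A)) : IsUnit A.det := by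
  rw [← Matrix.isUnit_iff_isUnit_det, ← Matrix.linearIndependent_cols_iff_isUnit]
  exact h.map' (WithLp.linearEquiv 2 ℂ (Fin n → ℂ)).toLinearMap (LinearEquiv.ker _)

lemma colDist_pos {n : ℕ} {A : Matrix (Fin n) (Fin n) ℂ}
    (h : LinearIndependent ℂ (colVec A)) (j : Fin n) : 0 < colDist A j := by
  have hcl : IsClosed (Submodule.span ℂ (colVec A '' {k | k ≠ j}) :
    Set (EuclideanSpace ℂ (Fin n))) := Submodule.closed_of_finiteDimensional _
  rw [colDist, ← hcl.notMem_iff_infDist_pos ⟨0, Submodule.zero_mem _⟩]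
  exact h.notMem_span_image (by simp)

lemma colDist_le_one {n : ℕ} {A : Matrix (Fin n) (Fin n) ℂ}
    (hunit : ∀ k, ‖colVec A k‖ = 1) (j : Fin n) : colDist A j ≤ 1 := by
  have := Metric.infDist_le_dist_of_mem (x := colVec A j)
    (Submodule.zero_mem (Submodule.span ℂ (colVec A '' {k | k ≠ j})))
  rwa [dist_zero_right, hunit] at this

/-- The conjugate `b` of row `j` is orthogonal to every other column, so subtracting `b / ‖w‖²` from
`a_j` lands in their span, at distance `1 / ‖w‖`. -/
lemma colDist_mul_norm_invRow_le {n : ℕ} {A : Matrix (Fin n) (Fin n) ℂ} (hA : IsUnit A.det)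
    (j : Fin n) : colDist A j * ‖invRow A j‖ ≤ 1 := by
  have hrow : ∀ l, ∑ r, A⁻¹ j r * A r l = if j = l then 1 else 0 := fun l => by
    rw [← Matrix.mul_apply, Matrix.nonsing_inv_mul A hA, Matrix.one_apply]
  set w := invRow A j with hw
  have hw0 : w ≠ 0 := by
    intro h
    have h1 := hrow j
    have h2 : ∀ r, A⁻¹ j r = 0 := fun r => congrArg (fun v : EuclideanSpace ℂ (Fin n) => v r) h
    simp [h2] at h1
  have hwn : 0 < ‖w‖ := norm_pos_iff.2 hw0
  let b : EuclideanSpace ℂ (Fin n) := WithLp.toLp 2 (star (A⁻¹ j))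
  have hbn : ‖b‖ = ‖w‖ := by simp [b, hw, invRow, EuclideanSpace.norm_eq]
  let z : EuclideanSpace ℂ (Fin n) := colVec A j - (((‖w‖ ^ 2)⁻¹ : ℝ) : ℂ) • b
  have hexp : ∀ v : EuclideanSpace ℂ (Fin n),
      v = ∑ k, (A⁻¹.mulVec (WithLp.ofLp v)) k • colVec A k := by
    intro v
    ext r
    have : A.mulVec (A⁻¹.mulVec (WithLp.ofLp v)) = WithLp.ofLp v := by
      rw [Matrix.mulVec_mulVec, Matrix.mul_nonsing_inv A hA, Matrix.one_mulVec]
    conv_lhs => rw [← this]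
    simp only [Matrix.mulVec, dotProduct, colVec, WithLp.ofLp_sum, WithLp.ofLp_smul,
      Finset.sum_apply, Pi.smul_apply, smul_eq_mul, mul_comm]
  -- The coordinate of `z` along `a_j` in the basis of columns vanishes.
  have hz0 : (A⁻¹.mulVec (WithLp.ofLp z)) j = 0 := by
    have h1 : (A⁻¹.mulVec (WithLp.ofLp (colVec A j))) j = 1 := by
      have := hrow j
      simpa [Matrix.mulVec, dotProduct, colVec] using this
    have h2 : (A⁻¹.mulVec (WithLp.ofLp b)) j = ((‖w‖ ^ 2 : ℝ) : ℂ) := by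
      simp [Matrix.mulVec, dotProduct, b, hw, invRow, EuclideanSpace.norm_sq_eq, Complex.mul_conj,
        Complex.normSq_eq_norm_sq]
    simp only [z, WithLp.ofLp_sub, WithLp.ofLp_smul, Matrix.mulVec_sub, Matrix.mulVec_smul,
      Pi.sub_apply, Pi.smul_apply, h1, h2, smul_eq_mul]
    norm_cast
    field_simp
    simp
  have hz : z ∈ Submodule.span ℂ (colVec A '' {k | k ≠ j}) := by
    rw [hexp z]
    refine Submodule.sum_mem _ fun k _ => ?_
    by_cases hk : k = j
    · rw [hk, hz0, zero_smul]; exact Submodule.zero_mem _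
    · exact Submodule.smul_mem _ _ (Submodule.subset_span ⟨k, hk, rfl⟩)
  have hle : colDist A j ≤ ‖w‖⁻¹ := by
    refine (Metric.infDist_le_dist_of_mem hz).trans_eq ?_
    rw [dist_eq_norm]
    simp only [z, sub_sub_cancel, norm_smul, hbn, Complex.norm_real, norm_inv, norm_pow, norm_norm]
    field_simp
  calc colDist A j * ‖w‖ ≤ ‖w‖⁻¹ * ‖w‖ := by gcongr
    _ = 1 := inv_mul_cancel₀ hwn.ne'

lemma logDistPotential_nonneg {n : ℕ} {A : Matrix (Fin n) (Fin n) ℂ}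
    (hunit : ∀ k, ‖colVec A k‖ = 1) : 0 ≤ logDistPotential A := by
  rw [logDistPotential, neg_nonneg]
  exact Finset.sum_nonpos fun j _ =>
    Real.log_nonpos Metric.infDist_nonneg (colDist_le_one hunit j)

lemma invExcess_le {n : ℕ} {A : Matrix (Fin n) (Fin n) ℂ}
    (hunit : ∀ k, ‖colVec A k‖ = 1) (h : LinearIndependent ℂ (colVec A)) :
    invExcess A ≤ n * Real.exp (2 * logDistPotential A) := by
  have hA := isUnit_det_of_linearIndependent_colVec h
  have hrow : ∀ j, ‖invRow A j‖ ^ 2 ≤ Real.exp (2 * logDistPotential A) := by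
    intro j
    have hd := colDist_pos h j
    have h1 : ‖invRow A j‖ ≤ Real.exp (-Real.log (colDist A j)) := by
      rw [Real.exp_neg, Real.exp_log hd, ← one_div, le_div_iff₀ hd, mul_comm]
      exact colDist_mul_norm_invRow_le hA j
    have h2 : -Real.log (colDist A j) ≤ logDistPotential A := by
      rw [logDistPotential, ← Finset.sum_neg_distrib]
      exact Finset.single_le_sum (f := fun j => -Real.log (colDist A j))
        (fun i _ => neg_nonneg.2
          (Real.log_nonpos Metric.infDist_nonneg (colDist_le_one hunit i))) (Finset.mem_univ j)
    calc ‖invRow A j‖ ^ 2 ≤ Real.exp (logDistPotential A) ^ 2 := by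
          gcongr; exact h1.trans (Real.exp_le_exp.2 h2)
      _ = Real.exp (2 * logDistPotential A) := by rw [← Real.exp_nat_mul]; norm_num
  rw [invExcess_eq_sum_norm]
  have := Finset.sum_le_sum fun j (_ : j ∈ Finset.univ) => hrow j
  simp only [Finset.sum_const, Finset.card_univ, Fintype.card_fin, nsmul_eq_mul] at this
  linarith [Nat.cast_nonneg (α := ℝ) n]

end

/-! ### Expectation of the excess along the random iteration. -/

noncomputable section

lemma integral_uniformOn_univ {β : Type*} [Fintype β] [Nonempty β] [MeasurableSpace β]
    [MeasurableSingletonClass β] (f : β → ℝ) :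
    ∫ b, f b ∂(uniformOn (Set.univ : Set β)) = (Fintype.card β : ℝ)⁻¹ * ∑ b, f b := by
  have : IsProbabilityMeasure (uniformOn (Set.univ : Set β)) :=
    isProbabilityMeasure_uniformOn Set.finite_univ Set.univ_nonempty
  rw [integral_fintype .of_finite, Finset.mul_sum]
  refine Finset.sum_congr rfl fun b _ => ?_
  rw [Measure.real, uniformOn_univ]
  simp

/-- Averaging over a uniform variable independent of the rest. -/
lemma integral_indep_uniform {Ω α β : Type*} [MeasurableSpace Ω] {P : Measure Ω}
    [IsProbabilityMeasure P] [Finite α] [MeasurableSpace α] [MeasurableSingletonClass α]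
    [Fintype β] [Nonempty β] [MeasurableSpace β] [MeasurableSingletonClass β]
    {Y : Ω → α} {Z : Ω → β} (hY : AEMeasurable Y P)
    (hZ : HasLaw Z (uniformOn (Set.univ : Set β)) P) (hYZ : IndepFun Y Z P) (f : α → β → ℝ) :
    ∫ ω, f (Y ω) (Z ω) ∂P = ∫ ω, (Fintype.card β : ℝ)⁻¹ * ∑ b, f (Y ω) b ∂P := by
  have hp : IsProbabilityMeasure (uniformOn (Set.univ : Set β)) :=
    isProbabilityMeasure_uniformOn Set.finite_univ Set.univ_nonempty
  have hpY : IsProbabilityMeasure (P.map Y) := Measure.isProbabilityMeasure_map hY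
  have hmap : P.map (fun ω => (Y ω, Z ω)) = (P.map Y).prod (uniformOn (Set.univ : Set β)) := by
    rw [hYZ.map_prod_eq_prod_map_map hY hZ.aemeasurable, hZ.map_eq]
  calc ∫ ω, f (Y ω) (Z ω) ∂P
      = ∫ q, f q.1 q.2 ∂(P.map (fun ω => (Y ω, Z ω))) :=
        (integral_map (f := fun q : α × β => f q.1 q.2) (hY.prodMk hZ.aemeasurable)
          (measurable_of_finite _).aestronglyMeasurable).symm
    _ = ∫ a, ∫ b, f a b ∂(uniformOn (Set.univ : Set β)) ∂(P.map Y) := by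
        rw [hmap, integral_prod _ .of_finite]
    _ = ∫ a, (Fintype.card β : ℝ)⁻¹ * ∑ b, f a b ∂(P.map Y) := by
        simp only [integral_uniformOn_univ]
    _ = _ := integral_map hY (measurable_of_finite _).aestronglyMeasurable

lemma orthIter_congr {n : ℕ} (A : Matrix (Fin n) (Fin n) ℂ) {p q : ℕ → IdxPair n} {t : ℕ}
    (h : ∀ s < t, p s = q s) : orthIter A p t = orthIter A q t := by
  induction t with
  | zero => rfl
  | succ t ih =>
    rw [orthIter, orthIter, ih fun s hs => h s (by omega), h t (by omega)]

lemma orthIter_invariant {n : ℕ} {A : Matrix (Fin n) (Fin n) ℂ} (hunit : ∀ k, ‖colVec A k‖ = 1)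
    (hA : IsUnit A.det) (p : ℕ → IdxPair n) (t : ℕ) :
    (∀ k, ‖colVec (orthIter A p t) k‖ = 1) ∧ IsUnit (orthIter A p t).det := by
  induction t with
  | zero => exact ⟨hunit, hA⟩
  | succ t ih =>
    exact ⟨norm_colVec_orthStep ih.1 ih.2 (p t), isUnit_det_orthStep ih.2 (p t)⟩

/-- The iterate as a function of the finitely many indices it depends on. -/
def orthIterFin {n : ℕ} (A : Matrix (Fin n) (Fin n) ℂ) (p₀ : IdxPair n) (t : ℕ)
    (y : Finset.range t → IdxPair n) : Matrix (Fin n) (Fin n) ℂ :=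
  -- The filler `p₀` is never read in the first `t` steps. The domain is finite, which settles
  -- measurability and integrability.
  orthIter A (fun s => if h : s ∈ Finset.range t then y ⟨s, h⟩ else p₀) t

lemma orthIterFin_restrict {n : ℕ} (A : Matrix (Fin n) (Fin n) ℂ) (p₀ : IdxPair n) (t : ℕ)
    (p : ℕ → IdxPair n) : orthIterFin A p₀ t (fun s => p s) = orthIter A p t :=
  orthIter_congr A fun s hs => by simp [hs]

section Iterates

variable {n : ℕ} {A : Matrix (Fin n) (Fin n) ℂ} {Ω : Type*} [MeasurableSpace Ω]
  {P : Measure Ω} [IsProbabilityMeasure P] {X : ℕ → Ω → IdxPair n}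

lemma integrable_invExcess_orthIter [Nonempty (IdxPair n)] (A : Matrix (Fin n) (Fin n) ℂ)
    (hX : ∀ s, AEMeasurable (X s) P) (t : ℕ) :
    Integrable (fun ω => invExcess (orthIter A (fun s => X s ω) t)) P := by
  have hY : AEMeasurable (fun ω (s : Finset.range t) => X s ω) P :=
    aemeasurable_pi_lambda _ fun s => hX s
  have h : Integrable (fun y => invExcess (orthIterFin A (Classical.arbitrary _) t y))
      (P.map (fun ω (s : Finset.range t) => X s ω)) := by
    have := Measure.isProbabilityMeasure_map (μ := P) hY
    exact .of_finite
  have := h.comp_aemeasurable hY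
  refine this.congr (.of_forall fun ω => ?_)
  simp only [Function.comp]
  rw [orthIterFin_restrict A _ t (fun s => X s ω)]

lemma integral_invExcess_orthIter [Nonempty (IdxPair n)] (hunit : ∀ k, ‖colVec A k‖ = 1)
    (hA : IsUnit A.det) (hlaw : ∀ s, HasLaw (X s) (uniformOn (Set.univ : Set (IdxPair n))) P)
    (hXindep : iIndepFun X P) (t : ℕ) :
    ∫ ω, invExcess (orthIter A (fun s => X s ω) t) ∂P
      = (((n : ℝ) * (n - 1))⁻¹ * (n * (n - 1) - 2)) ^ t * invExcess A := by
  induction t with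
  | zero => simp [orthIter]
  | succ t ih =>
    have hY : AEMeasurable (fun ω (s : Finset.range t) => X s ω) P :=
      aemeasurable_pi_lambda _ fun s => (hlaw s).aemeasurable
    -- The past indices and the current one come from the disjoint index sets `range t` and `{t}`.
    have hind : IndepFun (fun ω (s : Finset.range t) => X s ω) (X t) P := by
      have := hXindep.indepFun_finset₀ (Finset.range t) {t} (by simp)
        fun s => (hlaw s).aemeasurable
      exact this.comp measurable_id (measurable_pi_apply (⟨t, by simp⟩ : ({t} : Finset ℕ)))
    have h := integral_indep_uniform hY (hlaw t) hind
      fun y b => invExcess (orthStep (orthIterFin A (Classical.arbitrary _) t y) b)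
    have hr : ∀ ω, orthIterFin A (Classical.arbitrary _) t (fun s => X s ω)
        = orthIter A (fun s => X s ω) t :=
      fun ω => orthIterFin_restrict A _ t (fun s => X s ω)
    simp only [hr] at h
    simp only [orthIter]
    rw [h]
    have hs : ∀ ω, (Fintype.card (IdxPair n) : ℝ)⁻¹ *
        ∑ b, invExcess (orthStep (orthIter A (fun s => X s ω) t) b)
        = (((n : ℝ) * (n - 1))⁻¹ * (n * (n - 1) - 2)) *
          invExcess (orthIter A (fun s => X s ω) t) := by
      intro ω
      obtain ⟨h1, h2⟩ := orthIter_invariant hunit hA (fun s => X s ω) t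
      rw [sum_invExcess_orthStep h1 h2, card_idxPair, mul_assoc]
    simp only [hs]
    rw [integral_const_mul, ih, pow_succ]
    ring

/-- Markov's inequality for the excess after `t` steps. -/
lemma prob_condNumber_ge_le (hn : 2 ≤ n) (hunit : ∀ k, ‖colVec A k‖ = 1)
    (hA : IsUnit A.det) (hlaw : ∀ s, HasLaw (X s) (uniformOn (Set.univ : Set (IdxPair n))) P)
    (hXindep : iIndepFun X P) (t : ℕ) {ε : ℝ} (hε : 0 < ε) (hε1 : ε ≤ 1) :
    P.real {ω | 1 + ε ≤ condNumber (orthIter A (fun s => X s ω) t)}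
      ≤ Real.exp (-(2 * t / n ^ 2)) * invExcess A / ε ^ 2 := by
  have : Nonempty (IdxPair n) :=
    ⟨⟨(⟨0, by omega⟩, ⟨1, by omega⟩), by simp⟩⟩
  have hinv := fun ω => orthIter_invariant hunit hA (fun s => X s ω) t
  rw [le_div_iff₀ (by positivity), mul_comm]
  calc ε ^ 2 * P.real {ω | 1 + ε ≤ condNumber (orthIter A (fun s => X s ω) t)}
      ≤ ε ^ 2 * P.real {ω | ε ^ 2 ≤ invExcess (orthIter A (fun s => X s ω) t)} := by
        refine mul_le_mul_of_nonneg_left (measureReal_mono fun ω h => ?_) (by positivity)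
        exact sq_le_invExcess hn (hinv ω).1 (hinv ω).2 hε hε1 h
    _ ≤ ∫ ω, invExcess (orthIter A (fun s => X s ω) t) ∂P :=
        mul_meas_ge_le_integral_of_nonneg
          (.of_forall fun ω => invExcess_nonneg (hinv ω).1 (hinv ω).2)
          (integrable_invExcess_orthIter A (fun s => (hlaw s).aemeasurable) t) _
    _ = (((n : ℝ) * (n - 1))⁻¹ * (n * (n - 1) - 2)) ^ t * invExcess A :=
        integral_invExcess_orthIter hunit hA hlaw hXindep t
    _ ≤ Real.exp (-(2 * t / n ^ 2)) * invExcess A := by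
        have hn' : (2 : ℝ) ≤ n := by exact_mod_cast hn
        have hN : (2 : ℝ) ≤ n * (n - 1) := by nlinarith
        have hN0 : (0 : ℝ) < n * (n - 1) := by linarith
        refine mul_le_mul_of_nonneg_right ?_ (invExcess_nonneg hunit hA)
        have h1 : ((n : ℝ) * (n - 1))⁻¹ * (n * (n - 1) - 2) ≤ Real.exp (-(2 / n ^ 2)) := by
          have h2 : ((n : ℝ) * (n - 1))⁻¹ * (n * (n - 1) - 2) = -(2 / (n * (n - 1))) + 1 := by
            rw [mul_sub, inv_mul_cancel₀ hN0.ne']; ring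
          rw [h2]
          refine le_trans ?_ (Real.add_one_le_exp _)
          gcongr
          nlinarith
        calc _ ≤ Real.exp (-(2 / n ^ 2)) ^ t := by
              -- The contraction factor is nonnegative because `n ≥ 2` gives `n (n - 1) ≥ 2`.
              refine pow_le_pow_left₀ (mul_nonneg (inv_nonneg.2 hN0.le) (by linarith)) h1 t
          _ = _ := by rw [← Real.exp_nat_mul]; congr 1; ring

end Iterates

end

/-! ### Numerical consequences of the conditions on `t`. -/

lemma two_mul_le_div_sq {n Φ t : ℝ} (hn : 1 ≤ n) (hΦ : 0 ≤ Φ)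
    (h1 : 200 * n ^ 2 * Φ * Real.log (7 * Φ / n) ≤ t) (h2 : 48 * n ^ 4 ≤ t) :
    2 * Φ ≤ t / n ^ 2 := by
  have hn0 : 0 < n := by linarith
  rw [le_div_iff₀ (by positivity)]
  -- For `Φ ≤ n` the condition with `n⁴` suffices; for `Φ ≥ n` the logarithm is at least `log 7 ≥
  -- 1`.
  rcases le_total Φ n with h | h
  · have : 2 * Φ * n ^ 2 ≤ 2 * n * n ^ 2 := by gcongr
    nlinarith [pow_le_pow_left₀ (by norm_num) hn 3, pow_pos hn0 3]
  · have hlog : 1 ≤ Real.log (7 * Φ / n) := by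
      rw [Real.le_log_iff_exp_le (by have := hn0.trans_le h; positivity),
        le_div_iff₀ hn0]
      nlinarith [Real.exp_one_lt_d9]
    have : 200 * n ^ 2 * Φ * 1 ≤ 200 * n ^ 2 * Φ * Real.log (7 * Φ / n) := by gcongr
    have : 0 ≤ n ^ 2 * Φ := by positivity
    nlinarith

/-- One half of the decay `exp(-2t/n²)` absorbs `exp(2Φ)`, the other half absorbs `n / (δ ε²)`
through `y ≤ exp y`. -/
lemma exp_mul_div_le {n Φ t ε δ : ℝ} (hn : 1 ≤ n) (hε : 0 < ε) (hδ : 0 < δ)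
    (hΦ : 2 * Φ ≤ t / n ^ 2) (h : 48 * n ^ 4 / (δ * ε ^ 2) ≤ t) :
    Real.exp (-(2 * t / n ^ 2)) * (n * Real.exp (2 * Φ)) / ε ^ 2 ≤ δ := by
  have hn0 : 0 < n := by linarith
  have hy : n / (δ * ε ^ 2) ≤ t / n ^ 2 := by
    rw [le_div_iff₀ (by positivity)]
    refine le_trans ?_ h
    rw [div_mul_eq_mul_div]
    refine div_le_div_of_nonneg_right ?_ (by positivity)
    nlinarith [pow_le_pow_left₀ (by norm_num) hn 3, pow_pos hn0 3]
  have hexp : n ≤ δ * ε ^ 2 * Real.exp (t / n ^ 2) := by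
    have := hy.trans ((by linarith : t / n ^ 2 ≤ t / n ^ 2 + 1).trans (Real.add_one_le_exp _))
    rwa [div_le_iff₀ (by positivity), mul_comm] at this
  rw [div_le_iff₀ (by positivity)]
  calc Real.exp (-(2 * t / n ^ 2)) * (n * Real.exp (2 * Φ))
      ≤ Real.exp (-(2 * t / n ^ 2)) *
        ((δ * ε ^ 2 * Real.exp (t / n ^ 2)) * Real.exp (t / n ^ 2)) := by gcongr
    _ = δ * ε ^ 2 * Real.exp (-(2 * t / n ^ 2) + t / n ^ 2 + t / n ^ 2) := by
        rw [Real.exp_add, Real.exp_add]; ring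
    _ = δ * ε ^ 2 := by
        rw [show -(2 * t / n ^ 2) + t / n ^ 2 + t / n ^ 2 = 0 by ring]; simp

/-- One sequence serves as both `ε` and `δ`, hence the cube. With `ε t = 1 / (200 (t+1)^(1/4))` the
requirement grows only like `t^(3/4)`; `200` keeps `ε t` below `0.01`, and `8000000 = 200³`. -/
lemma exists_rate (C : ℝ) : ∃ ε : ℕ → ℝ, (∀ t, ε t ∈ Set.Ioo (0 : ℝ) 0.01) ∧
    Tendsto ε atTop (𝓝 0) ∧ ∀ᶠ t : ℕ in atTop, C / (ε t * ε t ^ 2) ≤ t := by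
  let s : ℕ → ℝ := fun t => √(√(t + 1))
  have hs1 : ∀ t, 1 ≤ s t := fun t =>
    Real.one_le_sqrt.2 (Real.one_le_sqrt.2 (by linarith [Nat.cast_nonneg (α := ℝ) t]))
  have hs4 : ∀ t : ℕ, s t ^ 4 = t + 1 := fun t => by
    rw [show s t ^ 4 = (s t ^ 2) ^ 2 by ring, Real.sq_sqrt (by positivity),
      Real.sq_sqrt (by positivity)]
  have hst : Tendsto s atTop atTop :=
    Real.tendsto_sqrt_atTop.comp (Real.tendsto_sqrt_atTop.comp
      (tendsto_atTop_add_const_right _ _ tendsto_natCast_atTop_atTop))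
  refine ⟨fun t => (200 * s t)⁻¹, fun t => ⟨?_, ?_⟩, ?_, ?_⟩
  · have := hs1 t; positivity
  · have := hs1 t
    rw [inv_lt_comm₀ (by positivity) (by norm_num)]
    norm_num; linarith
  · exact tendsto_inv_atTop_zero.comp (hst.const_mul_atTop (by norm_num))
  · filter_upwards [hst.eventually_ge_atTop (8000000 * C + 1)] with t ht
    have h1 := hs1 t
    have h3 : 1 ≤ s t ^ 3 := one_le_pow₀ h1
    have : C / ((200 * s t)⁻¹ * (200 * s t)⁻¹ ^ 2) = 8000000 * C * s t ^ 3 := by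
      field_simp; ring
    rw [this]
    have h4 := hs4 t
    nlinarith [mul_le_mul_of_nonneg_right ht (by positivity : 0 ≤ s t ^ 3)]

theorem theorem2p9 {n : ℕ} (hn : 2 ≤ n)
    (A : Matrix (Fin n) (Fin n) ℂ)
    (hunit : ∀ k, ‖colVec A k‖ = 1)
    (hindep : LinearIndependent ℂ (colVec A))
    {Ω : Type*} [MeasurableSpace Ω] (P : Measure Ω) [IsProbabilityMeasure P]
    (X : ℕ → Ω → IdxPair n)
    (hlaw : ∀ s, HasLaw (X s) (uniformOn (Set.univ : Set (IdxPair n))) P)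
    (hXindep : iIndepFun X P) :
    (∀ ε ∈ Set.Ioo (0 : ℝ) 0.01, ∀ δ ∈ Set.Ioo (0 : ℝ) 0.01, ∀ t : ℕ,
      200 * (n : ℝ) ^ 2 * logDistPotential A * Real.log (7 * logDistPotential A / n) ≤ (t : ℝ) →
      48 * (n : ℝ) ^ 4 / (δ * ε ^ 2) ≤ (t : ℝ) →
      P.real {ω | 1 + ε ≤ condNumber (orthIter A (fun s => X s ω) t)} ≤ δ) ∧
    (∃ ε δ : ℕ → ℝ,
      (∀ t, ε t ∈ Set.Ioo (0 : ℝ) 0.01) ∧ (∀ t, δ t ∈ Set.Ioo (0 : ℝ) 0.01) ∧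
      Tendsto ε atTop (𝓝 0) ∧ Tendsto δ atTop (𝓝 0) ∧
      ∀ᶠ t : ℕ in atTop,
        200 * (n : ℝ) ^ 2 * logDistPotential A * Real.log (7 * logDistPotential A / n) ≤ (t : ℝ) ∧
        48 * (n : ℝ) ^ 4 / (δ t * ε t ^ 2) ≤ (t : ℝ) ∧
        P.real {ω | 1 + ε t ≤ condNumber (orthIter A (fun s => X s ω) t)} ≤ δ t) := by
  have hA := isUnit_det_of_linearIndependent_colVec hindep
  have hn1 : (1 : ℝ) ≤ n := by exact_mod_cast (by omega : 1 ≤ n)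
  have main : ∀ ε ∈ Set.Ioo (0 : ℝ) 0.01, ∀ δ ∈ Set.Ioo (0 : ℝ) 0.01, ∀ t : ℕ,
      200 * (n : ℝ) ^ 2 * logDistPotential A * Real.log (7 * logDistPotential A / n) ≤ (t : ℝ) →
      48 * (n : ℝ) ^ 4 / (δ * ε ^ 2) ≤ (t : ℝ) →
      P.real {ω | 1 + ε ≤ condNumber (orthIter A (fun s => X s ω) t)} ≤ δ := by
    intro ε ⟨hε, hε1⟩ δ ⟨hδ, hδ1⟩ t h1 h2
    norm_num at hε1 hδ1
    have hδε : δ * ε ^ 2 ≤ 1 :=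
      mul_le_one₀ (by linarith) (by positivity) (pow_le_one₀ hε.le (by linarith))
    have h3 : 48 * (n : ℝ) ^ 4 ≤ t :=
      (le_div_self (by positivity) (by positivity) hδε).trans h2
    refine (prob_condNumber_ge_le hn hunit hA hlaw hXindep t hε (by linarith)).trans ?_
    refine le_trans ?_ (exp_mul_div_le hn1 hε hδ
      (two_mul_le_div_sq hn1 (logDistPotential_nonneg hunit) h1 h3) h2)
    gcongr
    exact invExcess_le hunit hindep
  refine ⟨main, ?_⟩
  obtain ⟨ε, hε, hlim, hrate⟩ := exists_rate (48 * (n : ℝ) ^ 4)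
  refine ⟨ε, ε, hε, hε, hlim, hlim, ?_⟩
  filter_upwards [hrate, tendsto_natCast_atTop_atTop.eventually_ge_atTop
    (200 * (n : ℝ) ^ 2 * logDistPotential A * Real.log (7 * logDistPotential A / n))] with t h2 h1
  exact ⟨h1, h2, main _ (hε t) _ (hε t) t h1 h2⟩
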